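/- Let $K_n^{(s)}$ be the complete $s$-uniform hypergraph on $n$ vertices, whose edges are all the $s$-subsets of an $n$-set. Let $e_1,\dots,e_k$ be a list of $k$ distinct edges of $K_n^{(s)}$. - It is a *Berge path* of length $k$ if there are $k+1$ distinct vertices $v_1,\dots,v_{k+1}$ with $v_i,v_{i+1}\in e_i$ for all $1\le i\le k$. - It is a *loose path* of length $k$ if $e_i\cap e_{i+1}\neq\emptyset$ for all $1\le i<k$ and $e_i\cap e_j=\emptyset$ whenever $|i-j|\ge 2$. - It is a *linear path* of length $k$ if $|e_i\cap e_{i+1}|=1$ for all $1\le i<k$ and $e_i\cap e_j=\emptyset$ whenever $|i-j|\ge 2$. Write $\mathcal B_k$, $\mathcal P_k$ and $\mathbb P_k$ for the Berge, loose and linear paths of length $k$, respectively. For each of these classes $\mathcal F$, let $ar(n,s,\mathcal F)$ be the smallest integer $c\ge 1$ such that every coloring of the edges of $K_n^{(s)}$ with exactly $c$ colors contains a member of $\mathcal F$ whose edges have pairwise distinct colors. **Theorem 1.2.** - (i) For all $s\ge 3$ and $n\ge 3s-4$, $ar(n,s,\mathbb P_2)=2$. - (ii) For every $s\ge 4$ there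 is $n_0(s)$ such that for all $n\ge n_0(s)$, $ar(n,s,\mathbb P_3)=\binom{n-2}{s-2}+2$. - (iii) For all $s\ge 2$ and $n\ge 3s-4$, $ar(n,s,\mathcal B_2)=ar(n,s,\mathcal P_2)=2$. - (iv) For all $s\ge 2$ and $n\ge 4s-3$, $ar(n,s,\mathcal B_3)=ar(n,s,\mathcal P_3)=3$. -/

import Mathlib

namespace HyperPath

/-- The edges of the complete `s`-uniform hypergraph on the vertex set `Fin n`. -/
abbrev Edge (n s : ℕ) : Type := {e : Finset (Fin n) // e.card = s}

variable {V : Type*} [DecidableEq V] {k : ℕ}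

/-- The listed edges form a Berge path of length `k`: they are distinct, and there are `k + 1`
distinct vertices such that the `i`-th edge contains the `i`-th and the `(i+1)`-st of them. -/
def IsBerge (e : Fin k → Finset V) : Prop :=
  Function.Injective e ∧
    ∃ v : Fin (k + 1) → V, Function.Injective v ∧ ∀ i : Fin k, v i.castSucc ∈ e i ∧ v i.succ ∈ e i

/-- The listed edges form a loose path of length `k`: they are distinct, consecutive edges
intersect, and nonconsecutive edges are disjoint. -/
def IsLoose (e : Fin k → Finset V) : Prop :=
  Function.Injective e ∧
    (∀ i j : Fin k, (i : ℕ) + 1 = j → (e i ∩ e j).Nonempty) ∧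
    (∀ i j : Fin k, (i : ℕ) + 1 < j → Disjoint (e i) (e j))

/-- The listed edges form a linear path of length `k`: they are distinct, consecutive edges
intersect in exactly one vertex, and nonconsecutive edges are disjoint. -/
def IsLinear (e : Fin k → Finset V) : Prop :=
  Function.Injective e ∧
    (∀ i j : Fin k, (i : ℕ) + 1 = j → (e i ∩ e j).card = 1) ∧
    (∀ i j : Fin k, (i : ℕ) + 1 < j → Disjoint (e i) (e j))

/-- The anti-Ramsey number of a class `P` of `k`-edge configurations: the least `c ≥ 1` such that
every coloring of the complete `s`-uniform hypergraph on `n` vertices with exactly `c` colors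
(a surjection onto `Fin c`) has a rainbow configuration in `P`. Every `c` larger than the number
of edges qualifies, so the least one exists. -/
noncomputable def antiRamsey (n s k : ℕ) (P : (Fin k → Finset (Fin n)) → Prop) : ℕ :=
  sInf {c : ℕ | 1 ≤ c ∧ ∀ col : Edge n s → Fin c, Function.Surjective col →
    ∃ e : Fin k → Edge n s, P (fun i => (e i).1) ∧ Function.Injective (fun i => col (e i))}

/-- The anti-Ramsey number of the linear path of length `k`. -/
noncomputable def arLinear (n s k : ℕ) : ℕ := antiRamsey n s k IsLinear

/-- The anti-Ramsey number of the family of Berge paths of length `k`. -/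
noncomputable def arBerge (n s k : ℕ) : ℕ := antiRamsey n s k IsBerge

/-- The anti-Ramsey number of the family of loose paths of length `k`. -/
noncomputable def arLoose (n s k : ℕ) : ℕ := antiRamsey n s k IsLoose

end HyperPath

namespace HyperPath

open Finset

/-! In (i), (iii) and (iv) the lower bound is immediate: `k` edges cannot be rainbow in `k - 1`
colours. For length two, join any two edges by single-vertex swaps. A non-constant colouring changes
at some swap, which gives intersecting edges of different colours, or, through an edge meeting both
swapped edges once, two that meet in one vertex (`exists_card_inter_eq_one_ne`).

For length three the engine is `RainbowFree.eq_or_eq`: given room for connecting edges, a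
two-coloured link imposes its two colours on every edge disjoint from it. In the loose case, an edge
of a third colour is then disjoint from any two disjoint edges of different colours. Hence there are
three pairwise disjoint edges of distinct colours, and an edge meeting two of them has no possible
colour. Loose paths of length three are Berge paths when `s ≥ 2`, so the Berge case follows.

In the linear case a single colour dominates off a bounded set, and representatives of the other
colours pairwise share at least two vertices. For large `n` such a family has at most `(n -
2).choose (s - 2)` members (`card_le_choose_of_two_intersecting`). The edges through a fixed pair
attain this, and `pairColoring` turns them into the extremal colouring. -/

theorem exists_color_ne_ne {V α : Type*} {s : ℕ} {c : Finset V → α} {A B C : Finset V}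
    (hA : A.card = s) (hB : B.card = s) (hC : C.card = s)
    (hAB : c A ≠ c B) (hAC : c A ≠ c C) (hBC : c B ≠ c C) (p q : α) :
    ∃ h : Finset V, h.card = s ∧ c h ≠ p ∧ c h ≠ q := by
  by_contra! H
  have h1 := H A hA
  have h2 := H B hB
  have h3 := H C hC
  by_cases hA : c A = p <;> by_cases hB : c B = p <;> by_cases hC : c C = p <;> simp_all

/-! ### Swaps and connecting edges -/

section Colorings

variable {V α : Type*} [DecidableEq V] {s : ℕ} {c : Finset V → α}

theorem insert_inter_eq_singleton {x : V} {T g : Finset V} (hx : x ∈ g) (hT : ∀ z ∈ T, z ∉ g) :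
    insert x T ∩ g = {x} := by
  rw [insert_inter_of_mem hx, disjoint_iff_inter_eq_empty.1 (disjoint_left.2 hT)]
  rfl

/-- A colouring of the `s`-subsets of `U` that is unchanged by swapping one vertex is constant. -/
theorem eq_of_forall_swap {U : Finset V}
    (h : ∀ T ⊆ U, T.card + 1 = s → ∀ x ∈ U, ∀ y ∈ U, x ∉ T → y ∉ T → x ≠ y →
      c (insert x T) = c (insert y T)) {A B : Finset V}
    (hA : A ⊆ U) (hB : B ⊆ U) (hAs : A.card = s) (hBs : B.card = s) : c A = c B := by
  induction hm : (A \ B).card using Nat.strong_induction_on generalizing A with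
  | _ m ih =>
    by_cases hAB : A ⊆ B
    · rw [eq_of_subset_of_card_le hAB (by omega)]
    · obtain ⟨a, ha, haB⟩ := not_subset.1 hAB
      have hBA : ¬ B ⊆ A := fun hBA => hAB (eq_of_subset_of_card_le hBA (by omega)).symm.subset
      obtain ⟨b, hb, hbA⟩ := not_subset.1 hBA
      have hT : (A.erase a).card + 1 = s := by rw [card_erase_add_one ha, hAs]
      have hbT : b ∉ A.erase a := fun h => hbA (mem_of_mem_erase h)
      have hswap := h (A.erase a) ((erase_subset _ _).trans hA) hT a (hA ha) b (hB hb)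
        (notMem_erase _ _) hbT (fun h => hbA (h ▸ ha))
      rw [insert_erase ha] at hswap
      rw [hswap]
      refine ih _ ?_ ?_ (by rw [card_insert_of_notMem hbT, hT]) rfl
      · rw [← hm]
        refine card_lt_card ⟨?_, fun h => ?_⟩
        · intro x
          simp only [mem_sdiff, mem_insert, mem_erase]
          rintro ⟨rfl | hx, hxB⟩
          · exact absurd hb hxB
          · exact ⟨hx.2, hxB⟩
        · have := h (mem_sdiff.2 ⟨ha, haB⟩)
          simp only [mem_sdiff, mem_insert, mem_erase] at this
          rcases this.1 with rfl | h
          · exact haB hb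
          · exact h.1 rfl
      · exact insert_subset (hB hb) ((erase_subset _ _).trans hA)

/-- A non-constant colouring of the `s`-subsets gives different colours to some pair of
intersecting sets that differ by one swap. -/
theorem exists_inter_nonempty_ne {U A B : Finset V} (hs : 2 ≤ s) (hA : A ⊆ U) (hB : B ⊆ U)
    (hAs : A.card = s) (hBs : B.card = s) (hne : c A ≠ c B) :
    ∃ e f : Finset V, e.card = s ∧ f.card = s ∧ (e ∩ f).Nonempty ∧ c e ≠ c f := by
  by_contra! H
  refine hne (eq_of_forall_swap (s := s) (fun T _ hTs x _ y _ hxT hyT _ => ?_) hA hB hAs hBs)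
  refine H _ _ (by rw [card_insert_of_notMem hxT, hTs]) (by rw [card_insert_of_notMem hyT, hTs]) ?_
  obtain ⟨t, ht⟩ := card_pos.1 (show 0 < T.card by omega)
  exact ⟨t, mem_inter.2 ⟨mem_insert_of_mem ht, mem_insert_of_mem ht⟩⟩

/-- If `U` has at least `2s - 1` vertices, a non-constant colouring of the `s`-subsets of `U`
gives different colours to two of them that meet in a single vertex. -/
theorem exists_card_inter_eq_one_ne {U A B : Finset V} (hs : 2 ≤ s) (hU : 2 * s ≤ U.card + 1)
    (hA : A ⊆ U) (hB : B ⊆ U) (hAs : A.card = s) (hBs : B.card = s) (hne : c A ≠ c B) :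
    ∃ e f : Finset V, e ⊆ U ∧ f ⊆ U ∧ e.card = s ∧ f.card = s ∧ (e ∩ f).card = 1 ∧ c e ≠ c f := by
  by_contra! H
  refine hne (eq_of_forall_swap (s := s) (fun T hTU hTs x hx y hy hxT hyT hxy => ?_) hA hB hAs hBs)
  have hxs : (insert x T).card = s := by rw [card_insert_of_notMem hxT, hTs]
  have hys : (insert y T).card = s := by rw [card_insert_of_notMem hyT, hTs]
  -- The edge made of `x`, `y` and `s - 2` fresh vertices meets both swapped edges in one vertex, so
  -- it shares their colour. This takes `(s + 1) + (s - 2) = 2s - 1` vertices.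
  have hcard : s - 2 ≤ (U \ insert x (insert y T)).card := by
    have := le_card_sdiff (insert x (insert y T)) U
    have := card_insert_le x (insert y T)
    omega
  obtain ⟨S, hS, hSs⟩ := exists_subset_card_eq hcard
  have hSx : x ∉ S := fun h => by simpa using hS h
  have hSy : y ∉ S := fun h => by simpa using hS h
  have hST : ∀ z ∈ S, z ∉ T := fun z hz hzT => by simpa [hzT] using hS hz
  have hSU : S ⊆ U := hS.trans sdiff_subset
  have hgs : (insert x (insert y S)).card = s := by
    rw [card_insert_of_notMem (by simp [hxy, hSx]), card_insert_of_notMem hSy, hSs]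
    omega
  have hgU : insert x (insert y S) ⊆ U := insert_subset hx (insert_subset hy hSU)
  have h1 : insert x T ∩ insert x (insert y S) = {x} :=
    insert_inter_eq_singleton (by simp) fun z hz => by
      simpa using ⟨ne_of_mem_of_not_mem hz hxT, ne_of_mem_of_not_mem hz hyT, fun h => hST z h hz⟩
  have h2 : insert y T ∩ insert x (insert y S) = {y} :=
    insert_inter_eq_singleton (by simp) fun z hz => by
      simpa using ⟨ne_of_mem_of_not_mem hz hxT, ne_of_mem_of_not_mem hz hyT, fun h => hST z h hz⟩
  rw [H _ _ (insert_subset hx hTU) hgU hxs hgs (by rw [h1, card_singleton]),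
    H _ _ (insert_subset hy hTU) hgU hys hgs (by rw [h2, card_singleton])]

/-- If `U` has at least `2s + 1` vertices, a non-constant colouring of the `s`-subsets of `U`
gives different colours to two disjoint ones. -/
theorem exists_disjoint_ne {U A B : Finset V} (hU : 2 * s + 1 ≤ U.card)
    (hA : A ⊆ U) (hB : B ⊆ U) (hAs : A.card = s) (hBs : B.card = s) (hne : c A ≠ c B) :
    ∃ e f : Finset V, e.card = s ∧ f.card = s ∧ Disjoint e f ∧ c e ≠ c f := by
  by_contra! H
  refine hne (eq_of_forall_swap (s := s) (fun T hTU hTs x hx y hy hxT hyT hxy => ?_) hA hB hAs hBs)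
  have hxs : (insert x T).card = s := by rw [card_insert_of_notMem hxT, hTs]
  have hys : (insert y T).card = s := by rw [card_insert_of_notMem hyT, hTs]
  have hcard : s ≤ (U \ insert x (insert y T)).card := by
    have := le_card_sdiff (insert x (insert y T)) U
    have := card_insert_le x (insert y T)
    omega
  obtain ⟨S, hS, hSs⟩ := exists_subset_card_eq hcard
  have hd : Disjoint (insert x (insert y T)) S :=
    disjoint_of_subset_right hS disjoint_sdiff
  rw [H _ S hxs hSs (disjoint_of_subset_left (by gcongr; exact subset_insert _ _) hd),
    H _ S hys hSs (disjoint_of_subset_left (subset_insert _ _) hd)]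

theorem exists_disjoint_subsets_card_eq {R : Finset V} {m : ℕ} (hR : 2 * m ≤ R.card) :
    ∃ Q Q' : Finset V, Q ⊆ R ∧ Q' ⊆ R ∧ Q.card = m ∧ Q'.card = m ∧ Disjoint Q Q' := by
  obtain ⟨Q, hQ, hQc⟩ := exists_subset_card_eq (show m ≤ R.card by omega)
  obtain ⟨Q', hQ', hQc'⟩ := exists_subset_card_eq (show m ≤ (R \ Q).card by
    rw [card_sdiff_of_subset hQ]; omega)
  exact ⟨Q, Q', hQ, hQ'.trans sdiff_subset, hQc, hQc', disjoint_of_subset_right hQ' disjoint_sdiff⟩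

/-- A colouring of the `s`-sets has no rainbow `e, f, g` with `e`, `g` disjoint and with both
`(e ∩ f).card` and `(f ∩ g).card` satisfying `P`. -/
def RainbowFree (P : ℕ → Prop) (s : ℕ) (c : Finset V → α) : Prop :=
  ∀ e f g : Finset V, e.card = s → f.card = s → g.card = s → P (e ∩ f).card → P (f ∩ g).card →
    Disjoint e g → c e = c f ∨ c f = c g ∨ c e = c g

/-- In a rainbow-free colouring, if `e₁`, `e₂` is a link with two colours, then an edge `f`
disjoint from both that can be joined to them by disjoint edges `g₁`, `g₂` has one of these
colours. -/
theorem RainbowFree.eq_or_eq {P : ℕ → Prop} (hc : RainbowFree P s c)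
    {e₁ e₂ f g₁ g₂ : Finset V} (h₁ : e₁.card = s) (h₂ : e₂.card = s) (hf : f.card = s)
    (hg₁ : g₁.card = s) (hg₂ : g₂.card = s) (h₁₂ : P (e₁ ∩ e₂).card)
    (hf₁ : Disjoint e₁ f) (hf₂ : Disjoint e₂ f)
    (hg₁e : P (g₁ ∩ e₁).card) (hg₁f : P (g₁ ∩ f).card) (hg₁d : Disjoint g₁ e₂)
    (hg₂e : P (g₂ ∩ e₂).card) (hg₂f : P (g₂ ∩ f).card) (hg₂d : Disjoint g₂ e₁)
    (hg : Disjoint g₁ g₂) (hne : c e₁ ≠ c e₂) : c f = c e₁ ∨ c f = c e₂ := by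
  -- If `f` had a third colour, `a₁` and `a₂` would force `c g₁ = c e₁`, and `b₁` and `b₂` would
  -- force `c g₂ = c e₂`. Then `g₁, f, g₂` would be rainbow.
  have a₁ := hc g₁ e₁ e₂ hg₁ h₁ h₂ hg₁e h₁₂ hg₁d
  have a₂ := hc e₁ g₁ f h₁ hg₁ hf (by rwa [inter_comm]) hg₁f hf₁
  have b₁ := hc g₂ e₂ e₁ hg₂ h₂ h₁ hg₂e (by rwa [inter_comm]) hg₂d
  have b₂ := hc e₂ g₂ f h₂ hg₂ hf (by rwa [inter_comm]) hg₂f hf₂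
  have d := hc g₁ f g₂ hg₁ hf hg₂ hg₁f (by rwa [inter_comm]) hg
  grind

theorem exists_mem_notMem_of_card_eq {e f : Finset V} (h : e.card = f.card) (hne : e ≠ f) :
    ∃ x ∈ e, x ∉ f := by
  by_contra! H
  exact hne (eq_of_subset_of_card_le H h.ge)

end Colorings

/-! ### Loose paths of length three -/

section Loose

variable {V α : Type*} [Fintype V] [DecidableEq V] {s : ℕ} {c : Finset V → α}

/-- In a colouring without rainbow loose path of length three, the edges disjoint from two
intersecting edges of different colours have one of these two colours. -/
theorem RainbowFree.loose_eq_or_eq (hs : 2 ≤ s) (hV : 4 * s ≤ Fintype.card V + 3)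
    (hc : RainbowFree (1 ≤ ·) s c)
    {e₁ e₂ f : Finset V} (h₁ : e₁.card = s) (h₂ : e₂.card = s) (hf : f.card = s)
    (h₁₂ : (e₁ ∩ e₂).Nonempty) (hf₁ : Disjoint e₁ f) (hf₂ : Disjoint e₂ f)
    (hne : c e₁ ≠ c e₂) : c f = c e₁ ∨ c f = c e₂ := by
  have hee : e₁ ≠ e₂ := fun h => hne (h ▸ rfl)
  obtain ⟨x, hx, hx'⟩ := exists_mem_notMem_of_card_eq (h₁.trans h₂.symm) hee
  obtain ⟨y, hy, hy'⟩ := exists_mem_notMem_of_card_eq (h₂.trans h₁.symm) hee.symm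
  obtain ⟨u, hu, v, hv, huv⟩ := one_lt_card.1 (show 1 < f.card by omega)
  have hue₁ := disjoint_right.1 hf₁ hu
  have hve₁ := disjoint_right.1 hf₁ hv
  have hue₂ := disjoint_right.1 hf₂ hu
  have hve₂ := disjoint_right.1 hf₂ hv
  -- The bound `4s - 3` is spent here: at most `2s - 1` vertices in the link, two in `f`, and `2(s -
  -- 2)` to fill the connecting edges, which may meet `f` again.
  have hR : 2 * (s - 2) ≤ (insert u (insert v (e₁ ∪ e₂)))ᶜ.card := by
    rw [card_compl]
    have := card_insert_le u (insert v (e₁ ∪ e₂))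
    have := card_insert_le v (e₁ ∪ e₂)
    have := card_union_add_card_inter e₁ e₂
    have := h₁₂.card_pos
    omega
  obtain ⟨Q, Q', hQ, hQ', hQc, hQc', hQQ⟩ := exists_disjoint_subsets_card_eq hR
  have hQm : ∀ z ∈ Q, z ≠ u ∧ z ≠ v ∧ z ∉ e₁ ∧ z ∉ e₂ := fun z hz => by
    simpa [not_or] using mem_compl.1 (hQ hz)
  have hQm' : ∀ z ∈ Q', z ≠ u ∧ z ≠ v ∧ z ∉ e₁ ∧ z ∉ e₂ := fun z hz => by
    simpa [not_or] using mem_compl.1 (hQ' hz)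
  have hQQm : ∀ z ∈ Q, z ∉ Q' := fun z hz => disjoint_left.1 hQQ hz
  refine hc.eq_or_eq (g₁ := insert x (insert u Q)) (g₂ := insert y (insert v Q')) h₁ h₂ hf
    ?_ ?_ h₁₂.card_pos hf₁ hf₂ ?_ ?_ ?_ ?_ ?_ ?_ ?_ hne
  · rw [card_insert_of_notMem (by grind), card_insert_of_notMem (by grind)]; omega
  · rw [card_insert_of_notMem (by grind), card_insert_of_notMem (by grind)]; omega
  · exact card_pos.2 ⟨x, by simp [hx]⟩
  · exact card_pos.2 ⟨u, by simp [hu]⟩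
  · rw [disjoint_left]; grind
  · exact card_pos.2 ⟨y, by simp [hy]⟩
  · exact card_pos.2 ⟨v, by simp [hv]⟩
  · rw [disjoint_left]; grind
  · rw [disjoint_left]; grind

/-- In a colouring without rainbow loose path of length three, an edge whose colour differs from
the two colours of disjoint edges `a`, `b` is disjoint from `a`. -/
theorem RainbowFree.loose_disjoint_left (hs : 2 ≤ s) (hV : 4 * s ≤ Fintype.card V + 3)
    (hc : RainbowFree (1 ≤ ·) s c) {a b h : Finset V} (ha : a.card = s) (hb : b.card = s)
    (hh : h.card = s) (hab : Disjoint a b) (hne : c a ≠ c b) (hha : c h ≠ c a) (hhb : c h ≠ c b) :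
    Disjoint h a := by
  by_contra hd
  rw [not_disjoint_iff_nonempty_inter] at hd
  by_cases hd' : Disjoint h b
  · have := hc.loose_eq_or_eq hs hV hh ha hb hd hd' hab hha
    grind
  · rw [not_disjoint_iff_nonempty_inter] at hd'
    have := hc a h b ha hh hb (by rw [inter_comm]; exact hd.card_pos) hd'.card_pos hab
    grind

/-- A colouring without rainbow loose path of length three has at most two colours. -/
theorem RainbowFree.loose_at_most_two (hs : 2 ≤ s) (hV : 4 * s ≤ Fintype.card V + 3)
    (hc : RainbowFree (1 ≤ ·) s c) {A B C : Finset V} (hA : A.card = s) (hB : B.card = s)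
    (hC : C.card = s) (hAB : c A ≠ c B) (hAC : c A ≠ c C) (hBC : c B ≠ c C) : False := by
  obtain ⟨a, b, ha, hb, hab, hne⟩ := exists_disjoint_ne (U := univ) (by rw [card_univ]; omega)
    (subset_univ A) (subset_univ B) hA hB hAB
  obtain ⟨h, hh, hha, hhb⟩ : ∃ h : Finset V, h.card = s ∧ c h ≠ c a ∧ c h ≠ c b :=
    exists_color_ne_ne hA hB hC hAB hAC hBC _ _
  have da := hc.loose_disjoint_left hs hV ha hb hh hab hne hha hhb
  have db := hc.loose_disjoint_left hs hV hb ha hh hab.symm hne.symm hhb hha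
  obtain ⟨x, hx⟩ := card_pos.1 (show 0 < a.card by omega)
  obtain ⟨y, hy⟩ := card_pos.1 (show 0 < b.card by omega)
  -- Among the pairwise disjoint `a`, `b`, `h`, two that include `a` or `b` have colours other than
  -- that of `g`, so `g` must miss one of `a`, `b`. But `g` meets both.
  obtain ⟨g, hxy, -, hg⟩ := exists_subsuperset_card_eq (subset_univ {x, y})
    (card_le_two.trans hs) (show s ≤ univ.card by rw [card_univ]; omega)
  have hga : ¬ Disjoint g a := not_disjoint_iff.2 ⟨x, hxy (by simp), hx⟩
  have hgb : ¬ Disjoint g b := not_disjoint_iff.2 ⟨y, hxy (by simp), hy⟩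
  by_cases h1 : c g = c a
  · exact hgb (hc.loose_disjoint_left hs hV hb hh hg db.symm hhb.symm (h1 ▸ hne) (h1 ▸ hha.symm))
  by_cases h2 : c g = c b
  · exact hga (hc.loose_disjoint_left hs hV ha hh hg da.symm hha.symm h1 (h2 ▸ hhb.symm))
  exact hga (hc.loose_disjoint_left hs hV ha hb hg hab hne h1 h2)

end Loose

/-! ### Families of sets pairwise sharing two vertices -/

/-- If a `2`-intersecting family of `s`-sets is not centred on a pair, then some bounded set meets
all its members in at least three vertices. -/
theorem exists_three_le_card_inter {V : Type*} [DecidableEq V] {s : ℕ}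
    {F : Finset (Finset V)} (hF : ∀ A ∈ F, A.card = s)
    (h2 : ∀ A ∈ F, ∀ B ∈ F, 2 ≤ (A ∩ B).card)
    (hp : ∀ p : Finset V, p.card = 2 → ∃ B ∈ F, ¬ p ⊆ B) {A : Finset V} (hA : A ∈ F) :
    ∃ T : Finset V, T.card ≤ s + s.choose 2 * s ∧ ∀ B ∈ F, 3 ≤ (B ∩ T).card := by
  choose! b hbF hb using hp
  refine ⟨A ∪ (A.powersetCard 2).biUnion b, ?_, fun B hB => ?_⟩
  · refine (card_union_le _ _).trans ?_
    rw [hF A hA]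
    gcongr
    refine (card_biUnion_le_card_mul _ _ s fun p hp => ?_).trans ?_
    · exact (hF _ (hbF p (mem_powersetCard.1 hp).2)).le
    · rw [card_powersetCard, hF A hA]
  -- Otherwise `B` meets the whole set in just the pair `p = B ∩ A`. Then `B` meets `b p` inside
  -- `p`, in at least two vertices, so `p ⊆ b p`, against the choice of `b p`.
  · by_contra! hlt
    have hsub : B ∩ A ⊆ B ∩ (A ∪ (A.powersetCard 2).biUnion b) :=
      inter_subset_inter_left subset_union_left
    have h2' := h2 B hB A hA
    have heq := eq_of_subset_of_card_le hsub (by omega)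
    have hpc : (B ∩ A).card = 2 := le_antisymm (by rw [heq]; omega) h2'
    have hpm : B ∩ A ∈ A.powersetCard 2 := mem_powersetCard.2 ⟨inter_subset_right, hpc⟩
    have hsub2 : B ∩ b (B ∩ A) ⊆ B ∩ A := by
      conv_rhs => rw [heq]
      exact inter_subset_inter_left
        ((subset_biUnion_of_mem b hpm).trans subset_union_right)
    have heq2 := eq_of_subset_of_card_le hsub2 (by rw [hpc]; exact h2 B hB _ (hbF _ hpc))
    exact hb _ hpc (heq2.ge.trans inter_subset_right)

section EKR

variable {V : Type*} [Fintype V] [DecidableEq V] {s : ℕ}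

theorem card_filter_superset {t : Finset V} (ht : t.card ≤ s) :
    ((univ.powersetCard s).filter (t ⊆ ·)).card =
      (Fintype.card V - t.card).choose (s - t.card) := by
  rw [← card_compl, ← card_powersetCard]
  refine card_bij' (fun e _ => e \ t) (fun e _ => e ∪ t) ?_ ?_ ?_ ?_
  · intro e he
    simp only [mem_filter, mem_powersetCard] at he ⊢
    refine ⟨fun z hz => by simpa using (mem_sdiff.1 hz).2, ?_⟩
    rw [card_sdiff_of_subset he.2, he.1.2]
  · intro e he
    simp only [mem_filter, mem_powersetCard] at he ⊢
    refine ⟨⟨subset_univ _, ?_⟩, subset_union_right⟩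
    rw [card_union_of_disjoint (disjoint_left.2 fun z hz => by simpa using he.1 hz), he.2]
    omega
  · intro e he
    exact sdiff_union_of_subset (mem_filter.1 he).2
  · intro e he
    simp only [mem_powersetCard] at he
    rw [union_sdiff_right, sdiff_eq_self_of_disjoint]
    exact disjoint_left.2 fun z hz => by simpa using he.1 hz

/-- For large vertex sets, a `2`-intersecting family of `s`-sets has at most
`(n - 2).choose (s - 2)` members. -/
theorem card_le_choose_of_two_intersecting (hs : 3 ≤ s)
    (hV : (s + s.choose 2 * s).choose 3 * (s - 2) + 3 ≤ Fintype.card V)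
    {F : Finset (Finset V)} (hF : ∀ A ∈ F, A.card = s)
    (h2 : ∀ A ∈ F, ∀ B ∈ F, 2 ≤ (A ∩ B).card) :
    F.card ≤ (Fintype.card V - 2).choose (s - 2) := by
  rcases F.eq_empty_or_nonempty with rfl | ⟨A, hA⟩
  · simp
  have hFp : ∀ B ∈ F, B ∈ univ.powersetCard s := fun B hB =>
    mem_powersetCard.2 ⟨subset_univ _, hF B hB⟩
  by_cases hp : ∃ p : Finset V, p.card = 2 ∧ ∀ B ∈ F, p ⊆ B
  · obtain ⟨p, hpc, hpB⟩ := hp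
    rw [← hpc, ← card_filter_superset (by omega)]
    exact card_le_card fun B hB => mem_filter.2 ⟨hFp B hB, hpB B hB⟩
  · push Not at hp
    obtain ⟨T, hT, h3⟩ := exists_three_le_card_inter hF h2 hp hA
    have hcover : F ⊆ (T.powersetCard 3).biUnion
        fun q => (univ.powersetCard s).filter (q ⊆ ·) := by
      intro B hB
      obtain ⟨q, hq, hqc⟩ := exists_subset_card_eq (h3 B hB)
      exact mem_biUnion.2 ⟨q, mem_powersetCard.2 ⟨hq.trans inter_subset_right, hqc⟩,
        mem_filter.2 ⟨hFp B hB, hq.trans inter_subset_left⟩⟩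
    have hle : F.card ≤ T.card.choose 3 * (Fintype.card V - 3).choose (s - 3) := by
      refine (card_le_card hcover).trans ?_
      rw [← card_powersetCard 3 T]
      refine card_biUnion_le_card_mul _ _ _ fun q hq => ?_
      have hqc := (mem_powersetCard.1 hq).2
      rw [card_filter_superset (by omega), hqc]
    have hmono : T.card.choose 3 ≤ (s + s.choose 2 * s).choose 3 := Nat.choose_le_choose 3 hT
    obtain ⟨m, hm⟩ : ∃ m, Fintype.card V = m + 3 := ⟨Fintype.card V - 3, by omega⟩
    obtain ⟨k, rfl⟩ : ∃ k, s = k + 3 := ⟨s - 3, by omega⟩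
    -- The identity `(n - 2) * (n - 3).choose (s - 3) = (n - 2).choose (s - 2) * (s - 2)` shows that
    -- the triple bound loses once `n - 2` is at least the constant times `s - 2`.
    have hid := Nat.add_one_mul_choose_eq m k
    rw [hm] at hle hV ⊢
    simp only [Nat.add_sub_cancel, show m + 3 - 2 = m + 1 by omega,
      show k + 3 - 2 = k + 1 by omega] at *
    generalize (k + 3 + (k + 3).choose 2 * (k + 3)).choose 3 = M at *
    refine Nat.le_of_mul_le_mul_right (c := k + 1) ?_ (by omega)
    rw [← hid]
    calc F.card * (k + 1) ≤ (M * m.choose k) * (k + 1) := by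
          gcongr; exact hle.trans (by gcongr)
      _ = (M * (k + 1)) * m.choose k := by ring
      _ ≤ (m + 1) * m.choose k := by gcongr; omega

end EKR

/-! ### Linear paths of length three -/

section Linear

variable {V α : Type*} [Fintype V] [DecidableEq V] {s : ℕ} {c : Finset V → α}

/-- In a colouring without rainbow linear path of length three, the edges disjoint from two
edges of different colours meeting in one vertex have one of these two colours. -/
theorem RainbowFree.linear_eq_or_eq (hs : 2 ≤ s) (hV : 5 * s ≤ Fintype.card V)
    (hc : RainbowFree (· = 1) s c)
    {e₁ e₂ f : Finset V} (h₁ : e₁.card = s) (h₂ : e₂.card = s) (hf : f.card = s)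
    (h₁₂ : (e₁ ∩ e₂).card = 1) (hf₁ : Disjoint e₁ f) (hf₂ : Disjoint e₂ f)
    (hne : c e₁ ≠ c e₂) : c f = c e₁ ∨ c f = c e₂ := by
  have hee : e₁ ≠ e₂ := fun h => hne (h ▸ rfl)
  obtain ⟨x, hx, hx'⟩ := exists_mem_notMem_of_card_eq (h₁.trans h₂.symm) hee
  obtain ⟨y, hy, hy'⟩ := exists_mem_notMem_of_card_eq (h₂.trans h₁.symm) hee.symm
  obtain ⟨u, hu, v, hv, huv⟩ := one_lt_card.1 (show 1 < f.card by omega)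
  have hue₁ := disjoint_right.1 hf₁ hu
  have hve₁ := disjoint_right.1 hf₁ hv
  have hue₂ := disjoint_right.1 hf₂ hu
  have hve₂ := disjoint_right.1 hf₂ hv
  have hxf := disjoint_left.1 hf₁ hx
  have hyf := disjoint_left.1 hf₂ hy
  -- Intersections must now be single vertices, so the fillers avoid all of `f` as well.
  have hR : 2 * (s - 2) ≤ (f ∪ (e₁ ∪ e₂))ᶜ.card := by
    rw [card_compl]
    have := card_union_le f (e₁ ∪ e₂)
    have := card_union_le e₁ e₂
    omega
  obtain ⟨Q, Q', hQ, hQ', hQc, hQc', hQQ⟩ := exists_disjoint_subsets_card_eq hR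
  have hQm : ∀ z ∈ Q, z ∉ f ∧ z ∉ e₁ ∧ z ∉ e₂ := fun z hz => by
    simpa [not_or] using mem_compl.1 (hQ hz)
  have hQm' : ∀ z ∈ Q', z ∉ f ∧ z ∉ e₁ ∧ z ∉ e₂ := fun z hz => by
    simpa [not_or] using mem_compl.1 (hQ' hz)
  have hQQm : ∀ z ∈ Q, z ∉ Q' := fun z hz => disjoint_left.1 hQQ hz
  refine hc.eq_or_eq (g₁ := insert x (insert u Q)) (g₂ := insert y (insert v Q')) h₁ h₂ hf
    ?_ ?_ h₁₂ hf₁ hf₂ ?_ ?_ ?_ ?_ ?_ ?_ ?_ hne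
  · rw [card_insert_of_notMem (by grind), card_insert_of_notMem (by grind)]; omega
  · rw [card_insert_of_notMem (by grind), card_insert_of_notMem (by grind)]; omega
  · rw [insert_inter_eq_singleton hx (by grind), card_singleton]
  · rw [insert_comm, insert_inter_eq_singleton hu (by grind), card_singleton]
  · rw [disjoint_left]; grind
  · rw [insert_inter_eq_singleton hy (by grind), card_singleton]
  · rw [insert_comm, insert_inter_eq_singleton hv (by grind), card_singleton]
  · rw [disjoint_left]; grind
  · rw [disjoint_left]; grind

/-- A colouring with three colours and no rainbow linear path of length three is constant, with
value `d`, outside some set of at most `3 * s` vertices. -/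
theorem RainbowFree.exists_monochromatic (hs : 2 ≤ s) (hV : 5 * s ≤ Fintype.card V)
    (hc : RainbowFree (· = 1) s c) {A B C : Finset V} (hA : A.card = s) (hB : B.card = s)
    (hC : C.card = s) (hAB : c A ≠ c B) (hAC : c A ≠ c C) (hBC : c B ≠ c C) :
    ∃ (R : Finset V) (d : α), R.card ≤ 3 * s ∧ ∀ f : Finset V, f.card = s → Disjoint f R →
      c f = d := by
  obtain ⟨a, b, -, -, ha, hb, hab, hne⟩ := exists_card_inter_eq_one_ne (U := univ) hs
    (by rw [card_univ]; omega) (subset_univ A) (subset_univ B) hA hB hAB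
  obtain ⟨h, hh, hha, hhb⟩ : ∃ h : Finset V, h.card = s ∧ c h ≠ c a ∧ c h ≠ c b :=
    exists_color_ne_ne hA hB hC hAB hAC hBC _ _
  have hRc : (h ∪ (a ∪ b)).card ≤ 3 * s := by
    have := card_union_le h (a ∪ b)
    have := card_union_le a b
    omega
  have hWc : 2 * s ≤ (h ∪ (a ∪ b))ᶜ.card := by rw [card_compl]; omega
  obtain ⟨w, hw, hwc⟩ := exists_subset_card_eq (show s ≤ (h ∪ (a ∪ b))ᶜ.card by omega)
  refine ⟨h ∪ (a ∪ b), c w, hRc, fun f hf hd => ?_⟩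
  by_contra hfw
  -- Two colours outside would give a link `p`, `q` there. The link `a`, `b` forces its colours to
  -- be those of `a` and `b`, while `p`, `q` forces one of them on `h`.
  obtain ⟨p, q, hpW, hqW, hp, hq, hpq, hpqc⟩ := exists_card_inter_eq_one_ne hs (by omega)
    (subset_compl_iff_disjoint_right.2 hd) hw hf hwc hfw
  have key : ∀ z ⊆ (h ∪ (a ∪ b))ᶜ, Disjoint h z ∧ Disjoint a z ∧ Disjoint b z := fun z hz => by
    have := (subset_compl_iff_disjoint_right.1 hz).symm
    simpa [disjoint_union_left] using this
  obtain ⟨p1, p2, p3⟩ := key p hpW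
  obtain ⟨q1, q2, q3⟩ := key q hqW
  have := hc.linear_eq_or_eq hs hV ha hb hp hab p2 p3 hne
  have := hc.linear_eq_or_eq hs hV ha hb hq hab q2 q3 hne
  have := hc.linear_eq_or_eq hs hV hp hq hh hpq p1.symm q1.symm hpqc
  grind

/-- In a colouring with three colours and no rainbow linear path of length three, any two edges of
distinct colours other than the dominant one share at least two vertices. -/
theorem RainbowFree.exists_two_le_card_inter (hs : 2 ≤ s) (hV : 6 * s ≤ Fintype.card V)
    (hc : RainbowFree (· = 1) s c) {A B C : Finset V} (hA : A.card = s) (hB : B.card = s)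
    (hC : C.card = s) (hAB : c A ≠ c B) (hAC : c A ≠ c C) (hBC : c B ≠ c C) :
    ∃ d : α, ∀ e f : Finset V, e.card = s → f.card = s → c e ≠ d → c f ≠ d → c e ≠ c f →
      2 ≤ (e ∩ f).card := by
  obtain ⟨R, d, hR, hd⟩ := hc.exists_monochromatic hs (by omega) hA hB hC hAB hAC hBC
  have h1 : ∀ e f : Finset V, e.card = s → f.card = s → c e ≠ d → c f ≠ d → c e ≠ c f →
      (e ∩ f).card ≠ 1 := by
    intro e f he hf hed hfd hef h
    have hcard : s ≤ (R ∪ (e ∪ f))ᶜ.card := by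
      rw [card_compl]
      have := card_union_le R (e ∪ f)
      have := card_union_le e f
      omega
    -- An edge `w` away from everything has colour `d`, yet the link `e`, `f` would force one of its
    -- own colours on it.
    obtain ⟨w, hw, hwc⟩ := exists_subset_card_eq hcard
    have hdis := subset_compl_iff_disjoint_right.1 hw
    simp only [disjoint_union_right] at hdis
    have := hd w hwc hdis.1
    have := hc.linear_eq_or_eq hs (by omega) he hf hwc h hdis.2.1.symm hdis.2.2.symm hef
    grind
  refine ⟨d, fun e f he hf hed hfd hef => ?_⟩
  -- If `e` and `f` were disjoint, an edge meeting each once would take the colour of one of them,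
  -- and with the other would contradict `h1`.
  have hne0 : (e ∩ f).card ≠ 0 := by
    intro h0
    have hdis : Disjoint e f := disjoint_iff_inter_eq_empty.2 (card_eq_zero.1 h0)
    obtain ⟨x, hx⟩ := card_pos.1 (show 0 < e.card by omega)
    obtain ⟨y, hy⟩ := card_pos.1 (show 0 < f.card by omega)
    have hcard : s - 2 ≤ (e ∪ f)ᶜ.card := by
      rw [card_compl]
      have := card_union_le e f
      omega
    obtain ⟨S, hS, hSc⟩ := exists_subset_card_eq hcard
    have hSm : ∀ z ∈ S, z ∉ e ∧ z ∉ f := fun z hz => by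
      simpa [not_or] using mem_compl.1 (hS hz)
    have hxf := disjoint_left.1 hdis hx
    have hye := disjoint_right.1 hdis hy
    have hg : (insert x (insert y S)).card = s := by
      rw [card_insert_of_notMem (by grind), card_insert_of_notMem (by grind)]; omega
    have hge : (insert x (insert y S) ∩ e).card = 1 := by
      rw [insert_inter_eq_singleton hx (by grind), card_singleton]
    have hgf : (insert x (insert y S) ∩ f).card = 1 := by
      rw [insert_comm, insert_inter_eq_singleton hy (by grind), card_singleton]
    have := hc e _ f he hg hf (by rwa [inter_comm]) hgf hdis
    have := h1 _ e hg he
    have := h1 _ f hg hf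
    grind
  have := h1 e f he hf hed hfd hef
  omega

/-- For large vertex sets, a colouring without rainbow linear path of length three has at most
`(n - 2).choose (s - 2) + 1` colours. -/
theorem RainbowFree.card_colors_le [Fintype α] [DecidableEq α] (hs : 3 ≤ s)
    (hV : (s + s.choose 2 * s).choose 3 * (s - 2) + 6 * s ≤ Fintype.card V)
    (hc : RainbowFree (· = 1) s c) (hsurj : ∀ i : α, ∃ e : Finset V, e.card = s ∧ c e = i) :
    Fintype.card α ≤ (Fintype.card V - 2).choose (s - 2) + 1 := by
  choose r hrs hrc using hsurj
  by_cases h3 : Fintype.card α ≤ 2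
  · have : 0 < (Fintype.card V - 2).choose (s - 2) := Nat.choose_pos (by omega)
    omega
  obtain ⟨i, j, k, hij, hik, hjk⟩ := Fintype.two_lt_card_iff.1 (not_le.1 h3)
  obtain ⟨d, hd⟩ := hc.exists_two_le_card_inter (by omega) (by omega) (hrs i) (hrs j) (hrs k)
    (by simpa [hrc]) (by simpa [hrc]) (by simpa [hrc])
  have hinj : Function.Injective r := Function.LeftInverse.injective hrc
  have := card_le_choose_of_two_intersecting hs (by omega) (F := (univ.erase d).image r)
    (by simp [hrs]) (by
      simp only [mem_image, mem_erase, mem_univ, and_true]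
      rintro _ ⟨i, hi, rfl⟩ _ ⟨j, hj, rfl⟩
      by_cases hij : i = j
      · rw [hij, inter_self, hrs]; omega
      · exact hd _ _ (hrs i) (hrs j) (by rwa [hrc]) (by rwa [hrc]) (by rwa [hrc, hrc]))
  rw [card_image_of_injective _ hinj, card_erase_of_mem (mem_univ _), card_univ] at this
  omega

end Linear

/-! ### Recognising short paths -/

theorem injective_fin_two {β : Type*} {e : Fin 2 → β} (h : e 0 ≠ e 1) : Function.Injective e := by
  intro i j hij
  fin_cases i <;> fin_cases j <;> first | rfl | exact absurd hij h | exact absurd hij.symm h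

theorem injective_fin_three {β : Type*} {e : Fin 3 → β} (h₀₁ : e 0 ≠ e 1) (h₁₂ : e 1 ≠ e 2)
    (h₀₂ : e 0 ≠ e 2) : Function.Injective e := by
  intro i j hij
  fin_cases i <;> fin_cases j <;> simp_all [eq_comm]

section Paths

variable {V : Type*} [DecidableEq V]

theorem isLinear_two {e : Fin 2 → Finset V} (hne : e 0 ≠ e 1) (h : (e 0 ∩ e 1).card = 1) :
    IsLinear e := by
  refine ⟨injective_fin_two hne, ?_, ?_⟩
  · intro i j hij
    fin_cases i <;> fin_cases j <;> simp_all
  · intro i j hij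
    omega

theorem isLoose_two {e : Fin 2 → Finset V} (hne : e 0 ≠ e 1) (h : (e 0 ∩ e 1).Nonempty) :
    IsLoose e := by
  refine ⟨injective_fin_two hne, ?_, ?_⟩
  · intro i j hij
    fin_cases i <;> fin_cases j <;> simp_all
  · intro i j hij
    omega

theorem isBerge_two {e : Fin 2 → Finset V} (hne : e 0 ≠ e 1) (hc : (e 0).card = (e 1).card)
    (h : (e 0 ∩ e 1).Nonempty) : IsBerge e := by
  obtain ⟨t, ht⟩ := h
  rw [mem_inter] at ht
  obtain ⟨x, hx, hx'⟩ := exists_mem_notMem_of_card_eq hc hne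
  obtain ⟨y, hy, hy'⟩ := exists_mem_notMem_of_card_eq hc.symm hne.symm
  refine ⟨(isLoose_two hne ⟨t, mem_inter.2 ht⟩).1, ![x, t, y], ?_, ?_⟩
  · have h1 : x ≠ t := fun h => hx' (h ▸ ht.2)
    have h2 : x ≠ y := fun h => hx' (h ▸ hy)
    have h3 : t ≠ y := fun h => hy' (h ▸ ht.1)
    intro i j hij
    fin_cases i <;> fin_cases j <;> simp_all
  · intro i
    fin_cases i
    · exact ⟨hx, ht.1⟩
    · exact ⟨ht.2, hy⟩

theorem isLinear_three {e : Fin 3 → Finset V} (he : Function.Injective e)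
    (h₀₁ : (e 0 ∩ e 1).card = 1) (h₁₂ : (e 1 ∩ e 2).card = 1) (h₀₂ : Disjoint (e 0) (e 2)) :
    IsLinear e := by
  refine ⟨he, ?_, ?_⟩ <;>
  · intro i j hij
    fin_cases i <;> fin_cases j <;> simp_all

theorem isLoose_three {e : Fin 3 → Finset V} (he : Function.Injective e)
    (h₀₁ : (e 0 ∩ e 1).Nonempty) (h₁₂ : (e 1 ∩ e 2).Nonempty) (h₀₂ : Disjoint (e 0) (e 2)) :
    IsLoose e := by
  refine ⟨he, ?_, ?_⟩ <;>
  · intro i j hij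
    fin_cases i <;> fin_cases j <;> simp_all

/-- The middle vertices come from the two intersections and the outer ones from the end edges;
disjointness of the end edges gives most of the distinctness. -/
theorem IsLoose.isBerge_three {e : Fin 3 → Finset V} (he : IsLoose e)
    (h₀ : 2 ≤ (e 0).card) (h₂ : 2 ≤ (e 2).card) : IsBerge e := by
  obtain ⟨t, ht⟩ := he.2.1 0 1 rfl
  obtain ⟨u, hu⟩ := he.2.1 1 2 rfl
  have hd := disjoint_left.1 (he.2.2 0 2 (by decide))
  rw [mem_inter] at ht hu
  obtain ⟨x, hx, hxt⟩ := exists_mem_ne h₀ t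
  obtain ⟨y, hy, hyu⟩ := exists_mem_ne h₂ u
  refine ⟨he.1, ![x, t, u, y], ?_, ?_⟩
  · have h1 : x ≠ u := fun h => hd hx (h ▸ hu.2)
    have h2 : x ≠ y := fun h => hd hx (h ▸ hy)
    have h3 : t ≠ u := fun h => hd ht.1 (h ▸ hu.2)
    have h4 : t ≠ y := fun h => hd ht.1 (h ▸ hy)
    intro i j hij
    fin_cases i <;> fin_cases j <;> simp_all
  · intro i
    fin_cases i
    · exact ⟨hx, ht.1⟩
    · exact ⟨ht.2, hu.1⟩
    · exact ⟨hu.2, hy⟩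

end Paths

/-! ### Anti-Ramsey numbers -/

section AntiRamsey

variable {n s k m : ℕ} {P : (Fin k → Finset (Fin n)) → Prop}

theorem exists_surjective_of_card_le {α β : Type*} [Fintype α] [Fintype β] [Nonempty β]
    (h : Fintype.card β ≤ Fintype.card α) : ∃ g : α → β, Function.Surjective g := by
  obtain ⟨f⟩ := Function.Embedding.nonempty_of_card_le h
  exact ⟨Function.invFun f, Function.invFun_surjective f.injective⟩

/-- A colouring with `m - 1` colours and no rainbow configuration, merged as needed, shows that
fewer than `m` colours do not suffice. -/
theorem antiRamsey_eq {β : Type*} [Fintype β] (hβ : Fintype.card β + 1 = m)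
    (col₀ : Edge n s → β) (hcol₀ : Function.Surjective col₀)
    (hno : ∀ e : Fin k → Edge n s, P (fun i => (e i).1) →
      ¬ Function.Injective (fun i => col₀ (e i)))
    (hup : ∀ col : Edge n s → Fin m, Function.Surjective col →
      ∃ e : Fin k → Edge n s, P (fun i => (e i).1) ∧ Function.Injective (fun i => col (e i))) :
    antiRamsey n s k P = m := by
  refine le_antisymm (Nat.sInf_le ⟨by omega, hup⟩) (le_csInf ⟨m, by omega, hup⟩ ?_)
  rintro c ⟨hc1, hc⟩
  by_contra! hlt
  have : Nonempty (Fin c) := ⟨⟨0, hc1⟩⟩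
  obtain ⟨g, hg⟩ := exists_surjective_of_card_le (α := β) (β := Fin c)
    (by rw [Fintype.card_fin]; omega)
  obtain ⟨e, he, hinj⟩ := hc (g ∘ col₀) (hg.comp hcol₀)
  exact hno e he (Function.Injective.of_comp (f := g) hinj)

/-- The bound `hn` guarantees a colouring onto `k - 1` colours; without one, smaller numbers of
colours would qualify vacuously. -/
theorem antiRamsey_eq_length (hk : 2 ≤ k) (hn : k - 1 ≤ n.choose s)
    (hup : ∀ col : Edge n s → Fin k, Function.Surjective col →
      ∃ e : Fin k → Edge n s, P (fun i => (e i).1) ∧ Function.Injective (fun i => col (e i))) :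
    antiRamsey n s k P = k := by
  have : Nonempty (Fin (k - 1)) := ⟨⟨0, by omega⟩⟩
  obtain ⟨g, hg⟩ := exists_surjective_of_card_le (α := Edge n s) (β := Fin (k - 1))
    (by rw [Fintype.card_fin, Fintype.card_finset_len, Fintype.card_fin]; exact hn)
  refine antiRamsey_eq (by rw [Fintype.card_fin]; omega) g hg (fun e _ hinj => ?_) hup
  have := Fintype.card_le_of_injective _ hinj
  simp only [Fintype.card_fin] at this
  omega

/-- Extension of a colouring of the edges to all sets of vertices by a default value. -/
def extendColoring {β : Type*} (col : Edge n s → β) (b : β) (e : Finset (Fin n)) : β :=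
  if h : e.card = s then col ⟨e, h⟩ else b

theorem extendColoring_apply {β : Type*} (col : Edge n s → β) (b : β) {e : Finset (Fin n)}
    (h : e.card = s) : extendColoring col b e = col ⟨e, h⟩ := dif_pos h

theorem extendColoring_val {β : Type*} (col : Edge n s → β) (b : β) (e : Edge n s) :
    extendColoring col b e.1 = col e := extendColoring_apply col b e.2

theorem exists_rainbow_two {P : (Fin 2 → Finset (Fin n)) → Prop} {β : Type*} {col : Edge n s → β}
    {b : β} {e f : Finset (Fin n)} (he : e.card = s) (hf : f.card = s)
    (hne : extendColoring col b e ≠ extendColoring col b f) (hP : e ≠ f → P ![e, f]) :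
    ∃ e : Fin 2 → Edge n s, P (fun i => (e i).1) ∧ Function.Injective (fun i => col (e i)) := by
  rw [extendColoring_apply col b he, extendColoring_apply col b hf] at hne
  refine ⟨![⟨e, he⟩, ⟨f, hf⟩], ?_, ?_⟩
  · convert hP (fun h => hne (by subst h; rfl)) using 1
    funext i
    fin_cases i <;> rfl
  · exact injective_fin_two hne

/-- A colouring without rainbow copy of `P` is rainbow-free as soon as `P` contains the triples
under consideration. -/
theorem rainbowFree_extendColoring {P : (Fin 3 → Finset (Fin n)) → Prop} {Q : ℕ → Prop}
    {β : Type*} {col : Edge n s → β} (b : β)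
    (hno : ¬ ∃ e : Fin 3 → Edge n s, P (fun i => (e i).1) ∧
      Function.Injective (fun i => col (e i)))
    (hP : ∀ e : Fin 3 → Finset (Fin n), Function.Injective e → (∀ i, (e i).card = s) →
      Q (e 0 ∩ e 1).card → Q (e 1 ∩ e 2).card → Disjoint (e 0) (e 2) → P e) :
    RainbowFree Q s (extendColoring col b) := by
  intro e f g he hf hg hef hfg heg
  by_contra! H
  rw [extendColoring_apply col b he, extendColoring_apply col b hf,
    extendColoring_apply col b hg] at H
  have hinj : Function.Injective
      fun i => col ((![⟨e, he⟩, ⟨f, hf⟩, ⟨g, hg⟩] : Fin 3 → Edge n s) i) :=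
    injective_fin_three H.1 H.2.1 H.2.2
  refine hno ⟨![⟨e, he⟩, ⟨f, hf⟩, ⟨g, hg⟩], hP _ ?_ ?_ hef hfg heg, hinj⟩
  · exact Subtype.val_injective.comp (Function.Injective.of_comp (f := col) hinj)
  · intro i
    exact ((![⟨e, he⟩, ⟨f, hf⟩, ⟨g, hg⟩] : Fin 3 → Edge n s) i).2

theorem exists_rainbow_three_of_loose {P : (Fin 3 → Finset (Fin n)) → Prop} (hs : 2 ≤ s)
    (hn : 4 * s ≤ n + 3)
    (hP : ∀ e : Fin 3 → Finset (Fin n), (∀ i, (e i).card = s) → IsLoose e → P e)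
    (col : Edge n s → Fin 3) (hcol : Function.Surjective col) :
    ∃ e : Fin 3 → Edge n s, P (fun i => (e i).1) ∧ Function.Injective (fun i => col (e i)) := by
  by_contra hno
  -- The default colour `0` plays no role: only sets of size `s` are compared.
  have hc := rainbowFree_extendColoring (Q := (1 ≤ ·)) 0 hno fun e he hes h₀₁ h₁₂ h₀₂ =>
    hP e hes (isLoose_three he (card_pos.1 h₀₁) (card_pos.1 h₁₂) h₀₂)
  obtain ⟨A, hA⟩ := hcol 0
  obtain ⟨B, hB⟩ := hcol 1
  obtain ⟨C, hC⟩ := hcol 2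
  refine hc.loose_at_most_two hs (by rwa [Fintype.card_fin]) A.2 B.2 C.2 ?_ ?_ ?_ <;>
    simp [extendColoring_val, hA, hB, hC]

theorem arLinear_two (hs : 2 ≤ s) (hsn : 2 * s ≤ n + 1) : arLinear n s 2 = 2 := by
  refine antiRamsey_eq_length le_rfl (Nat.choose_pos (by omega)) fun col hcol => ?_
  obtain ⟨A, hA⟩ := hcol 0
  obtain ⟨B, hB⟩ := hcol 1
  obtain ⟨e, f, -, -, he, hf, hef, hne⟩ :=
    exists_card_inter_eq_one_ne (c := extendColoring col 0) (U := univ) hs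
      (by simpa using hsn) (subset_univ A.1) (subset_univ B.1) A.2 B.2
      (by simp [extendColoring_val, hA, hB])
  exact exists_rainbow_two he hf hne fun h => isLinear_two h hef

theorem antiRamsey_two_of_inter {P : (Fin 2 → Finset (Fin n)) → Prop} (hs : 2 ≤ s) (hsn : s ≤ n)
    (hP : ∀ e f : Finset (Fin n), e.card = f.card → e ≠ f → (e ∩ f).Nonempty → P ![e, f]) :
    antiRamsey n s 2 P = 2 := by
  refine antiRamsey_eq_length le_rfl (Nat.choose_pos (by omega)) fun col hcol => ?_
  obtain ⟨A, hA⟩ := hcol 0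
  obtain ⟨B, hB⟩ := hcol 1
  obtain ⟨e, f, he, hf, hef, hne⟩ :=
    exists_inter_nonempty_ne (c := extendColoring col 0) (U := univ) hs
      (subset_univ A.1) (subset_univ B.1) A.2 B.2 (by simp [extendColoring_val, hA, hB])
  exact exists_rainbow_two he hf hne fun h => hP e f (he.trans hf.symm) h hef

theorem antiRamsey_three_of_loose {P : (Fin 3 → Finset (Fin n)) → Prop} (hs : 2 ≤ s)
    (hn : 4 * s ≤ n + 3)
    (hP : ∀ e : Fin 3 → Finset (Fin n), (∀ i, (e i).card = s) → IsLoose e → P e) :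
    antiRamsey n s 3 P = 3 := by
  refine antiRamsey_eq_length (by norm_num) ?_ (exists_rainbow_three_of_loose hs hn hP)
  obtain ⟨n, rfl⟩ : ∃ a, n = a + 1 := ⟨n - 1, by omega⟩
  obtain ⟨s, rfl⟩ : ∃ a, s = a + 1 := ⟨s - 1, by omega⟩
  have h1 : 0 < n.choose s := Nat.choose_pos (by omega)
  have h2 : 0 < n.choose (s + 1) := Nat.choose_pos (by omega)
  rw [Nat.choose_succ_succ']
  omega

/-- The edges containing the pair `p` get pairwise distinct colours, all others a further one. -/
def pairColoring (p : Finset (Fin n)) (e : Edge n s) :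
    Option ((univ.powersetCard s).filter (p ⊆ ·) : Finset (Finset (Fin n))) :=
  if h : p ⊆ e.1 then
    some ⟨e.1, mem_filter.2 ⟨mem_powersetCard.2 ⟨subset_univ _, e.2⟩, h⟩⟩
  else none

theorem pairColoring_surjective {p : Finset (Fin n)} (hp : p.Nonempty) (hsn : s < n) :
    Function.Surjective (pairColoring (s := s) p) := by
  rintro (_ | ⟨e, he⟩)
  · obtain ⟨x, hx⟩ := hp
    obtain ⟨e, he, hes⟩ := exists_subset_card_eq (s := univ.erase x) (n := s) (by
      rw [card_erase_of_mem (mem_univ _), card_univ, Fintype.card_fin]; omega)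
    exact ⟨⟨e, hes⟩, dif_neg fun h => by simpa using he (h hx)⟩
  · have he' := mem_filter.1 he
    exact ⟨⟨e, (mem_powersetCard.1 he'.1).2⟩, dif_pos he'.2⟩

/-- In a rainbow triple at most one edge misses `p`, so two edges contain it and share two vertices,
which no two edges of a linear path do. -/
theorem not_injective_pairColoring {p : Finset (Fin n)} (hp : p.card = 2) {e : Fin 3 → Edge n s}
    (he : IsLinear fun i => (e i).1) : ¬ Function.Injective fun i => pairColoring p (e i) := by
  intro hinj
  have hnone : ∀ i j : Fin 3, i ≠ j → p ⊆ (e i).1 ∨ p ⊆ (e j).1 := by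
    intro i j hij
    by_contra! H
    exact hij (hinj (by simp only [pairColoring, dif_neg H.1, dif_neg H.2]))
  have h2 : ∀ i j : Fin 3, p ⊆ (e i).1 → p ⊆ (e j).1 → 2 ≤ ((e i).1 ∩ (e j).1).card :=
    fun i j hi hj => hp ▸ card_le_card (subset_inter hi hj)
  have h01 := he.2.1 0 1 rfl
  have h12 := he.2.1 1 2 rfl
  have h02 := card_eq_zero.2 (disjoint_iff_inter_eq_empty.1 (he.2.2 0 2 (by decide)))
  have a01 := h2 0 1
  have a12 := h2 1 2
  have a02 := h2 0 2
  have b01 := hnone 0 1 (by decide)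
  have b12 := hnone 1 2 (by decide)
  have b02 := hnone 0 2 (by decide)
  by_cases p0 : p ⊆ (e 0).1 <;> by_cases p1 : p ⊆ (e 1).1 <;> by_cases p2 : p ⊆ (e 2).1 <;>
    simp_all

theorem arLinear_three (hs : 3 ≤ s) (hn : (s + s.choose 2 * s).choose 3 * (s - 2) + 6 * s ≤ n) :
    arLinear n s 3 = (n - 2).choose (s - 2) + 2 := by
  obtain ⟨p, -, hp⟩ := exists_subset_card_eq (s := (univ : Finset (Fin n))) (n := 2)
    (by rw [card_univ, Fintype.card_fin]; omega)
  refine antiRamsey_eq ?_ (pairColoring p)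
    (pairColoring_surjective (card_pos.1 (by omega)) (by omega))
    (fun e => not_injective_pairColoring hp) fun col hcol => ?_
  · rw [Fintype.card_option, Fintype.card_coe, card_filter_superset (by omega), hp,
      Fintype.card_fin]
  · by_contra hno
    have hc := rainbowFree_extendColoring (Q := (· = 1)) 0 hno fun e he _ h₀₁ h₁₂ h₀₂ =>
      isLinear_three he h₀₁ h₁₂ h₀₂
    have := hc.card_colors_le hs (by rwa [Fintype.card_fin]) fun i => by
      obtain ⟨e, he⟩ := hcol i
      exact ⟨e.1, e.2, by rw [extendColoring_val, he]⟩
    simp only [Fintype.card_fin] at this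
    omega

end AntiRamsey

end HyperPath

theorem theorem1p2 :
    (∀ s n : ℕ, 3 ≤ s → 3 * s ≤ n + 4 → HyperPath.arLinear n s 2 = 2) ∧
    (∀ s : ℕ, 4 ≤ s → ∃ N : ℕ, ∀ n : ℕ, N ≤ n →
      HyperPath.arLinear n s 3 = (n - 2).choose (s - 2) + 2) ∧
    (∀ s n : ℕ, 2 ≤ s → 3 * s ≤ n + 4 →
      HyperPath.arBerge n s 2 = 2 ∧ HyperPath.arLoose n s 2 = 2) ∧
    (∀ s n : ℕ, 2 ≤ s → 4 * s ≤ n + 3 →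
      HyperPath.arBerge n s 3 = 3 ∧ HyperPath.arLoose n s 3 = 3) := by
  -- For `s ≥ 3`, `3s - 4 ≥ 2s - 1`, which is all that linear paths of length two need; in (iii),
  -- `3s - 4 ≥ s` suffices.
  refine ⟨fun s n hs hn => HyperPath.arLinear_two (by omega) (by omega),
    fun s hs => ⟨_, fun n hn => HyperPath.arLinear_three (by omega) hn⟩,
    fun s n hs hn => ⟨?_, ?_⟩, fun s n hs hn => ⟨?_, ?_⟩⟩
  · exact HyperPath.antiRamsey_two_of_inter hs (by omega) fun e f h hne hef =>
      HyperPath.isBerge_two hne h hef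
  · exact HyperPath.antiRamsey_two_of_inter hs (by omega) fun e f _ hne hef =>
      HyperPath.isLoose_two hne hef
  · exact HyperPath.antiRamsey_three_of_loose hs hn fun e he hl =>
      hl.isBerge_three ((he 0).symm ▸ hs) ((he 2).symm ▸ hs)
  · exact HyperPath.antiRamsey_three_of_loose hs hn fun e _ hl => hl
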